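/- A network coding problem $P$ consists of a finite directed acyclic hypergraph with node set $\mathcal V$ and hyperedge set $\mathcal E$ (each $e\in\mathcal E$ has a transmitting node $\mathrm{tail}(e)\in\mathcal V$ and a set $\mathrm{head}(e)\subseteq\mathcal V$ of receiving nodes), a finite set $\mathcal S$ of sources, and for every $s\in\mathcal S$ a set $O(s)\subseteq\mathcal V$ of nodes where $s$ is available and a set $D(s)\subseteq\mathcal V$ of sink nodes where $s$ is demanded. Put $\mathrm{head}(s)=O(s)$ for $s\in\mathcal S$, $\mathrm{in}(u)=\{f\in\mathcal S\cup\mathcal E: u\in \mathrm{head}(f)\}$ and $\mathrm{in}(e)=\mathrm{in}(\mathrm{tail}(e))$. Let $\chi(P)=\mathbb R_{\ge0}^{\mathcal S}\times\mathbb R_{\ge0}^{\mathcal E}$ be the set of rate-capacity tuples. A network code for $P$ is given by random variables $(Y_f)_{f\in\mathcal S\cup\mathcal E}$ with finite alphabets such that the $Y_s$, $s\in\mathcal S$, are mutually independent, each is uniform on its support $\mathsf{SP}(Y_s)$, and each $Y_e$ is a function of $(Y_f: f\in\mathrm{in}(e))$. It is zero-error if $Y_s$ is determined by $(Y_f: f\in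 \mathrm{in}(u))$ for all $s$ and $u\in D(s)$. A tuple $(\lambda,\omega)\in\chi(P)$ is zero-error achievable if there are zero-error codes $Y^n$ and reals $c_n>0$ such that the limits below exist in $\mathbb R$ and $\lim_n c_n\log|\mathsf{SP}(Y^n_s)|\ge\lambda(s)$ for all $s\in\mathcal S$ and $\lim_n c_n\log|\mathsf{SP}(Y^n_e)|\le\omega(e)$ for all $e\in\mathcal E$. A function $h:2^{\mathcal S\cup\mathcal E}\to\mathbb R$ is entropic if $h(\alpha)=H(Y_i:i\in\alpha)$ for some family of random variables with finite alphabets, weakly entropic if $c\,h$ is entropic for some $c>0$, and almost entropic if it is a pointwise limit of a sequence of weakly entropic functions. Write $h(\alpha\mid\beta)=h(\alpha\cup\beta)-h(\beta)$. A tuple $(\lambda,\omega)\in\chi(P)$ satisfies Yeung's outer bound for $P$ if there are reals $c_n>0$ and almost entropic functions $h_n$ on $2^{\mathcal S\cup\mathcal E}$ with $h_n(\mathcal S)=\sum_{s}h_n(\{s\})$, $h_n(\{e\}\mid\mathrm{in}(e))=0$ for all $e\in\mathcal E$, and $h_n(\{s\}\mid\mathrm{in}(u))=0$ for all $s\in\mathcal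 S$, $u\in D(s)$, such that the limits exist in $\mathbb R$ and $\lim_n c_nh_n(\{e\})\le\omega(e)$ for all $e$ and $\lim_n c_nh_n(\{s\})\ge\lambda(s)$ for all $s$. From $P$ form $P^\dagger$ as follows. Its nodes are those of $P$ together with new nodes $\gamma_s$ ($s\in\mathcal S$), $\tau_{s,u}$ ($s\in\mathcal S,\ u\in D(s)$), $\psi,\phi,\eta,\eta^*$. Its hyperedges are those of $P$, with the same tails and heads, together with $a_s,b_s,c_s$ ($s\in\mathcal S$) and $d_{s,u}$ ($s\in\mathcal S,\ u\in D(s)$), where $\mathrm{tail}(a_s)=\mathrm{tail}(b_s)=\phi$, $\mathrm{tail}(c_s)=\gamma_s$, $\mathrm{tail}(d_{s,u})=u$, and $$\mathrm{head}(a_s)=O(s)\cup\{\gamma_s,\eta^*\},\qquad \mathrm{head}(b_s)=\{\gamma_s,\eta,\psi\}\cup\{\tau_{j,v}: j\ne s,\ v\in D(j)\},$$ $$\mathrm{head}(c_s)=\{\eta,\eta^*\}\cup\{\tau_{s,v}:v\in D(s)\},\qquad \mathrm{head}(d_{s,u})=\{\tau_{s,u}\}.$$ Its sources are $1',2'$,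 with $O^\dagger(1')=O^\dagger(2')=\{\phi\}$, $D^\dagger(1')=\{\tau_{s,u}: s\in\mathcal S,u\in D(s)\}\cup\{\eta,\eta^*,\psi\}$ and $D^\dagger(2')=\{\eta,\eta^*\}$. For $(\lambda,\omega)\in\chi(P)$ let $T^\dagger(\lambda,\omega)=(\lambda^\dagger,\omega^\dagger)$, where $\omega^\dagger(e)=\omega(e)$ for $e\in\mathcal E$, $\omega^\dagger(a_s)=\omega^\dagger(b_s)=\omega^\dagger(c_s)=\omega^\dagger(d_{s,u})=\lambda(s)$, and $\lambda^\dagger(1')=\lambda^\dagger(2')=\sum_{s\in\mathcal S}\lambda(s)$. Theorem. For every network coding problem $P$, $P^\dagger$ is a network coding problem with two colocated sources which is an incremental multicast (every sink that demands $2'$ also demands $1'$, i.e. $D^\dagger(2')\subseteq D^\dagger(1')$). For every $(\lambda,\omega)\in\chi(P)$ one has $T^\dagger(\lambda,\omega)\in\chi(P^\dagger)$, and: 1. if $T^\dagger(\lambda,\omega)$ satisfies Yeung's outer bound for $P^\dagger$, then $(\lambda,\omega)$ satisfies Yeung's outer bound for $P$; 2. if $(\lambda,\omega)$ is zero-error achievable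 for $P$, then $T^\dagger(\lambda,\omega)$ is zero-error achievable for $P^\dagger$. -/

import Mathlib

open Filter Topology

/-! ### Rank functions and entropy -/

/-- Rank functions on the ground set `N`: real functions on the power set of `N`. -/
abbrev RankFunction (N : Type*) := Set N → ℝ

/-- `h(α ∣ β) = h(α ∪ β) - h(β)`. -/
def RankFunction.cond {N : Type*} (h : RankFunction N) (α β : Set N) : ℝ :=
  h (α ∪ β) - h β

/-- Shannon entropy (in nats) of a random variable `X` with finite alphabet `A`, defined on the
discrete probability space `(Ω, p)`. -/
noncomputable def shannonEntropy {Ω A : Type*} (p : PMF Ω) (X : Ω → A) : ℝ :=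
  ∑' a, Real.negMulLog ((p.map X a).toReal)

/-- The entropy function `α ↦ H(Y_i, i ∈ α)` of a family of random variables. -/
noncomputable def entropyFunction {N Ω : Type*} {A : N → Type*} (p : PMF Ω)
    (Y : ∀ i, Ω → A i) : RankFunction N :=
  fun α => shannonEntropy p (fun ω (i : α) => Y i ω)

/-- `h` is the entropy function of a family of random variables with finite alphabets. -/
def IsEntropic {N : Type*} (h : RankFunction N) : Prop :=
  ∃ (Ω : Type) (p : PMF Ω) (A : N → Type) (_ : ∀ i, Finite (A i)) (Y : ∀ i, Ω → A i),
    h = entropyFunction p Y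

def IsWeaklyEntropic {N : Type*} (h : RankFunction N) : Prop :=
  ∃ c : ℝ, 0 < c ∧ IsEntropic (c • h)

/-- Limits of sequences of weakly entropic functions; for finite `N` the (pointwise) convergence
is convergence in the Euclidean space of rank functions. -/
def IsAlmostEntropic {N : Type*} (h : RankFunction N) : Prop :=
  ∃ g : ℕ → RankFunction N, (∀ n, IsWeaklyEntropic (g n)) ∧ Tendsto g atTop (𝓝 h)

/-! ### Network coding problems -/

/-- A network coding problem: a finite directed acyclic hypergraph with nodes `V` and hyperedges
`E`, together with a connection constraint with sources `S`. -/
structure NetworkCodingProblem (V E S : Type*) [Finite V] [Finite E] [Fintype S] where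
  /-- transmit node of a hyperedge -/
  tail : E → V
  /-- receiving nodes of a hyperedge -/
  head : E → Set V
  /-- nodes at which a source is available -/
  origin : S → Set V
  /-- nodes at which a source has to be reconstructed -/
  sinks : S → Set V
  /-- there is no directed cycle of hyperedges -/
  acyclic : ∀ e, ¬ Relation.TransGen (fun f g => tail g ∈ head f) e e

namespace NetworkCodingProblem

section
variable {V E S : Type*} [Finite V] [Finite E] [Fintype S] (P : NetworkCodingProblem V E S)

/-- `in(u)`: the source edges (`Sum.inl s`, with head `origin s`) and the hyperedges (`Sum.inr e`)
entering the node `u`. The set `in(e)` for a hyperedge `e` is `P.incoming (P.tail e)`. -/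
def incoming (u : V) : Set (S ⊕ E) :=
  {f | u ∈ Sum.elim P.origin P.head f}

/-- The sources are colocated. -/
def Colocated : Prop := ∀ s s', P.origin s = P.origin s'

/-- The problem is an incremental multicast with respect to the total order on its sources: a
receiver that wants source `s` also wants every source `i < s`. -/
def IncrementalMulticast [LinearOrder S] : Prop :=
  ∀ i s, i < s → P.sinks s ⊆ P.sinks i

/-- A network code for `P` with finite alphabets, together with its induced random variables. -/
structure NetworkCode where
  Alphabet : S ⊕ E → Type
  finite_alphabet : ∀ f, Finite (Alphabet f)
  /-- local encoding functions -/
  encoder : ∀ e : E, (∀ f : P.incoming (P.tail e), Alphabet f) → Alphabet (Sum.inr e)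
  /-- underlying discrete probability space -/
  Ω : Type
  prob : PMF Ω
  /-- the induced random variables -/
  Y : ∀ f, Ω → Alphabet f
  /-- each source message is uniformly distributed over its support -/
  uniform : ∀ s, ∀ y ∈ (prob.map (Y (Sum.inl s))).support,
    ∀ y' ∈ (prob.map (Y (Sum.inl s))).support,
      prob.map (Y (Sum.inl s)) y = prob.map (Y (Sum.inl s)) y'
  /-- the source messages are mutually independent -/
  indep : ∀ y : ∀ s : S, Alphabet (Sum.inl s),
    prob.map (fun ω s => Y (Sum.inl s) ω) y = ∏ s, prob.map (Y (Sum.inl s)) (y s)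
  /-- `Y_e = φ_e (Y_f : f ∈ in(e))` -/
  encode : ∀ ω ∈ prob.support, ∀ e : E, Y (Sum.inr e) ω = encoder e (fun f => Y f ω)

variable {P} in
/-- `log |SP(Y_f)|`, where `SP` denotes the support. -/
noncomputable def NetworkCode.logSupport (C : P.NetworkCode) (f : S ⊕ E) : ℝ :=
  Real.log ((C.prob.map (C.Y f)).support.ncard : ℝ)

variable {P} in
/-- Every source is determined by the messages received at each of its sink nodes. -/
def NetworkCode.ZeroError (C : P.NetworkCode) : Prop :=
  ∀ s, ∀ u ∈ P.sinks s,
    ∃ g : (∀ f : P.incoming u, C.Alphabet f) → C.Alphabet (Sum.inl s),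
      ∀ ω ∈ C.prob.support, C.Y (Sum.inl s) ω = g (fun f => C.Y f ω)

end

/-- Pairs of a source-rate vector `t.1` and a hyperedge-capacity vector `t.2`. -/
abbrev Tuple (E S : Type*) := (S → ℝ) × (E → ℝ)

section
variable {V E S : Type*} [Finite V] [Finite E] [Fintype S] (P : NetworkCodingProblem V E S)

/-- `χ(P)`: the rate-capacity tuples, i.e. those with nonnegative entries. -/
def rateCapacityTuples (_P : NetworkCodingProblem V E S) : Set (Tuple E S) :=
  {t | (∀ s, 0 ≤ t.1 s) ∧ ∀ e, 0 ≤ t.2 e}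

variable {P} in
/-- The tuple `t` is asymptotically fit for the sequence `C` of network codes. -/
def AsymptoticallyFit (t : Tuple E S) (C : ℕ → P.NetworkCode) : Prop :=
  ∃ c : ℕ → ℝ, (∀ n, 0 < c n) ∧
    (∀ s, ∃ l, Tendsto (fun n => c n * (C n).logSupport (Sum.inl s)) atTop (𝓝 l) ∧ t.1 s ≤ l) ∧
    (∀ e, ∃ l, Tendsto (fun n => c n * (C n).logSupport (Sum.inr e)) atTop (𝓝 l) ∧ l ≤ t.2 e)

/-- Zero-error achievability of a rate-capacity tuple. -/
def ZeroErrorAchievable (t : Tuple E S) : Prop :=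
  t ∈ P.rateCapacityTuples ∧
    ∃ C : ℕ → P.NetworkCode, AsymptoticallyFit t C ∧ ∀ n, (C n).ZeroError

/-- `CL(R)`: the rate-capacity tuples asymptotically dominated by rescaled tuples of `R`. -/
def CL (R : Set (Tuple E S)) : Set (Tuple E S) :=
  {t | t ∈ P.rateCapacityTuples ∧
    ∃ (r : ℕ → Tuple E S) (c : ℕ → ℝ), (∀ n, r n ∈ R) ∧ (∀ n, 0 < c n) ∧
      (∀ e, ∃ l, Tendsto (fun n => c n * (r n).2 e) atTop (𝓝 l) ∧ l ≤ t.2 e) ∧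
      (∀ s, ∃ l, Tendsto (fun n => c n * (r n).1 s) atTop (𝓝 l) ∧ t.1 s ≤ l)}

/-- The coordinate projection from rank functions on `S ∪ E` to tuples. -/
def proj (_P : NetworkCodingProblem V E S) (h : RankFunction (S ⊕ E)) : Tuple E S :=
  (fun s => h {Sum.inl s}, fun e => h {Sum.inr e})

/-- Source independence: `h(S) = ∑ₛ h(s)`. -/
def CI (_P : NetworkCodingProblem V E S) : Set (RankFunction (S ⊕ E)) :=
  {h | h (Set.range Sum.inl) = ∑ s, h {Sum.inl s}}

/-- Deterministic transmission: `h(e ∣ in(e)) = 0`. -/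
def CT : Set (RankFunction (S ⊕ E)) :=
  {h | ∀ e, h.cond {Sum.inr e} (P.incoming (P.tail e)) = 0}

/-- Decodability: `h(s ∣ in(u)) = 0` for every sink node `u` of `s`. -/
def CD : Set (RankFunction (S ⊕ E)) :=
  {h | ∀ s, ∀ u ∈ P.sinks s, h.cond {Sum.inl s} (P.incoming u) = 0}

/-- The region described by Yeung's outer bound. -/
def yeungOuterBound : Set (Tuple E S) :=
  P.CL (P.proj '' ({h | IsAlmostEntropic h} ∩ P.CI ∩ P.CT ∩ P.CD))

/-! ### The two-layer incremental multicast problem -/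

/-- Nodes of the transformed network; `tau s u` exists for `u ∈ sinks s`. -/
inductive DaggerNode
  | orig (v : V)
  | gamma (s : S)
  | tau (s : S) (u : P.sinks s)
  | psi
  | phi
  | eta
  | etaStar

/-- Hyperedges of the transformed network; `d s u` exists for `u ∈ sinks s`. -/
inductive DaggerEdge
  | orig (e : E)
  | a (s : S)
  | b (s : S)
  | c (s : S)
  | d (s : S) (u : P.sinks s)

instance : Finite P.DaggerNode := by
  let F : V ⊕ S ⊕ (Σ s, P.sinks s) ⊕ Fin 4 → P.DaggerNode
    | .inl v => .orig v
    | .inr (.inl s) => .gamma s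
    | .inr (.inr (.inl ⟨s, u⟩)) => .tau s u
    | .inr (.inr (.inr 0)) => .psi
    | .inr (.inr (.inr 1)) => .phi
    | .inr (.inr (.inr 2)) => .eta
    | .inr (.inr (.inr 3)) => .etaStar
  refine Finite.of_surjective F ?_
  rintro (v | s | ⟨s, u⟩ | _ | _ | _ | _)
  · exact ⟨.inl v, rfl⟩
  · exact ⟨.inr (.inl s), rfl⟩
  · exact ⟨.inr (.inr (.inl ⟨s, u⟩)), rfl⟩
  · exact ⟨.inr (.inr (.inr 0)), rfl⟩
  · exact ⟨.inr (.inr (.inr 1)), rfl⟩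
  · exact ⟨.inr (.inr (.inr 2)), rfl⟩
  · exact ⟨.inr (.inr (.inr 3)), rfl⟩

instance : Finite P.DaggerEdge := by
  let F : E ⊕ S ⊕ S ⊕ S ⊕ (Σ s, P.sinks s) → P.DaggerEdge
    | .inl e => .orig e
    | .inr (.inl s) => .a s
    | .inr (.inr (.inl s)) => .b s
    | .inr (.inr (.inr (.inl s))) => .c s
    | .inr (.inr (.inr (.inr ⟨s, u⟩))) => .d s u
  refine Finite.of_surjective F ?_
  rintro (e | s | s | s | ⟨s, u⟩)
  · exact ⟨.inl e, rfl⟩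
  · exact ⟨.inr (.inl s), rfl⟩
  · exact ⟨.inr (.inr (.inl s)), rfl⟩
  · exact ⟨.inr (.inr (.inr (.inl s))), rfl⟩
  · exact ⟨.inr (.inr (.inr (.inr ⟨s, u⟩))), rfl⟩

def daggerTail : P.DaggerEdge → P.DaggerNode
  | .orig e => .orig (P.tail e)
  | .a _ => .phi
  | .b _ => .phi
  | .c s => .gamma s
  | .d _ u => .orig u

def daggerHead : P.DaggerEdge → Set P.DaggerNode
  | .orig e => DaggerNode.orig '' P.head e
  | .a s => DaggerNode.orig '' P.origin s ∪ {.gamma s, .etaStar}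
  | .b s => {.gamma s, .eta, .psi} ∪ {w | ∃ j, j ≠ s ∧ ∃ v : P.sinks j, w = .tau j v}
  | .c s => {.eta, .etaStar} ∪ {w | ∃ v : P.sinks s, w = .tau s v}
  | .d s u => {.tau s u}

theorem dagger_acyclic (e : P.DaggerEdge) :
    ¬ Relation.TransGen (fun f g => P.daggerTail g ∈ P.daggerHead f) e e := by
  let rk : P.DaggerEdge → ℕ
    | .orig _ => 1
    | .a _ => 0
    | .b _ => 0
    | .c _ => 2
    | .d _ _ => 2
  let nxt : E → E → Prop := fun f g => P.tail g ∈ P.head f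
  have step : ∀ f g, P.daggerTail g ∈ P.daggerHead f →
      rk f < rk g ∨ ∃ x y, f = .orig x ∧ g = .orig y ∧ nxt x y := by
    rintro (x | s | s | s | ⟨s, u⟩) (y | s' | s' | s' | ⟨s', u'⟩) h <;>
      simp_all [daggerTail, daggerHead, rk, nxt]
  have key : ∀ f g, Relation.TransGen (fun f g => P.daggerTail g ∈ P.daggerHead f) f g →
      rk f < rk g ∨ ∃ x y, f = .orig x ∧ g = .orig y ∧ Relation.TransGen nxt x y := by
    intro f g h
    induction h with
    | single h =>
      rcases step _ _ h with h | ⟨x, y, rfl, rfl, hxy⟩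
      · exact .inl h
      · exact .inr ⟨x, y, rfl, rfl, .single hxy⟩
    | tail _ h ih =>
      rcases step _ _ h with h | ⟨x, y, rfl, rfl, hxy⟩
      · rcases ih with ih | ⟨x, y, rfl, rfl, -⟩
        · exact .inl (ih.trans h)
        · exact .inl h
      · rcases ih with ih | ⟨x', y', rfl, e, ih⟩
        · exact .inl ih
        · cases e
          exact .inr ⟨x', y, rfl, rfl, ih.tail hxy⟩
  intro h
  rcases key e e h with h | ⟨x, y, rfl, e, h⟩
  · exact lt_irrefl _ h
  · cases e
    exact P.acyclic _ h

/-- The transformed problem. Its two sources `1'` and `2'` are `0 : Fin 2` and `1 : Fin 2`. -/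
def dagger : NetworkCodingProblem P.DaggerNode P.DaggerEdge (Fin 2) where
  tail := P.daggerTail
  head := P.daggerHead
  origin := fun _ => {.phi}
  sinks := ![{w | ∃ s, ∃ u : P.sinks s, w = .tau s u} ∪ {.eta, .etaStar, .psi}, {.eta, .etaStar}]
  acyclic := P.dagger_acyclic

/-- The tuple map `T†`. -/
def daggerTuple (t : Tuple E S) : Tuple P.DaggerEdge (Fin 2) :=
  (fun _ => ∑ s, t.1 s,
   fun
    | .orig e => t.2 e
    | .a s => t.1 s
    | .b s => t.1 s
    | .c s => t.1 s
    | .d s _ => t.1 s)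

end

end NetworkCodingProblem

/-! Outer bound. Let Λ be the sum of the rates λ(s). The rank functions in question form a closed
cone, so compactness replaces the sequence in Yeung's bound by one almost entropic h, which is a
polymatroid (`exists_of_mem_yeungOuterBound`). The sink η recovers both sources, of joint rank at
least 2Λ, from the b_s and c_s, whose capacities sum to 2Λ; hence these edges are independent and
saturated. As c_s is a function of a_s and b_s, the same holds for the a_s and b_s
(`eq_sum_of_layer`). The sink ψ makes 1' equivalent to the family of all b_j. So b_s can be
recovered at τ_{s,u}, and a rank count makes d_{s,u} a function of c_s and all b_j, hence of a_s and
all b_j. It is also a function of the a_j, from which all original edges are computed. Independence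
leaves the pair (a_s, d_{s,u}) no more rank than d_{s,u} itself has, so d_{s,u}, and with it the
node u, determines a_s (`determined_edgeA`). Thus h restricted to the a_s and the original edges
witnesses the bound for P.

Achievability. Send 2' on the a_s, an independent one-time pad 1' on the b_s, and c_s = a_s + b_s;
run the given code on the a_s and put the decoded a_s on d_{s,u} (`NetworkCode.exists_dagger`).
Block coding adjusts message sizes so that the rates are exactly λ(s) in the limit. -/

/-! ### Shannon inequalities -/

/-- Rank functions of polymatroids. -/
structure IsPolymatroid {N : Type*} (h : RankFunction N) : Prop where
  empty : h ∅ = 0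
  mono : ∀ {α β : Set N}, α ⊆ β → h α ≤ h β
  submod : ∀ α β : Set N, h (α ∪ β) + h (α ∩ β) ≤ h α + h β

section FiberMass

open Classical in
/-- The total mass of the fibre of `F` through `t`. -/
noncomputable def fiberMass {T A : Type*} [Fintype T] (q : T → ℝ) (F : T → A) (t : T) : ℝ :=
  ∑ t', if F t' = F t then q t' else 0

variable {T A B D K : Type*} [Fintype T] {q : T → ℝ}

theorem le_fiberMass (hq : ∀ t, 0 ≤ q t) (F : T → A) (t : T) : q t ≤ fiberMass q F t := by
  classical
  have h := Finset.single_le_sum (f := fun t' => if F t' = F t then q t' else 0)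
    (fun i _ => by split_ifs <;> simp [hq]) (Finset.mem_univ t)
  simpa [fiberMass] using h

theorem fiberMass_nonneg (hq : ∀ t, 0 ≤ q t) (F : T → A) (t : T) : 0 ≤ fiberMass q F t :=
  (hq t).trans (le_fiberMass hq F t)

theorem fiberMass_congr (F : T → A) {t u : T} (h : F t = F u) :
    fiberMass q F t = fiberMass q F u := by
  unfold fiberMass
  rw [h]

theorem fiberMass_anti (hq : ∀ t, 0 ≤ q t) (F : T → A) (G : T → B)
    (h : ∀ t u, F t = F u → G t = G u) (t : T) : fiberMass q F t ≤ fiberMass q G t := by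
  classical
  refine Finset.sum_le_sum fun u _ => ?_
  by_cases h1 : F u = F t
  · simp [h1, h _ _ h1]
  · simp only [h1, if_false]
    split_ifs <;> simp [hq]

-- Entropy becomes the mean of minus the log of the mass of one's own fibre. The sum runs over `T`
-- for every `F`, so entropies of different functions can be compared term by term.
open Classical in
theorem sum_negMulLog_fiber [Fintype A] (q : T → ℝ) (F : T → A) :
    ∑ a, Real.negMulLog (∑ t, if F t = a then q t else 0) =
      -∑ t, q t * Real.log (fiberMass q F t) := by
  simp only [Real.negMulLog, neg_mul, Finset.sum_neg_distrib, Finset.sum_mul, ite_mul, zero_mul]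
  rw [Finset.sum_comm]
  simp [fiberMass]

/-- The double counting behind the nonnegativity of conditional mutual information. -/
theorem sum_mul_fiberMass_div_le (hq : ∀ t, 0 ≤ q t) (F : T → A) (G : T → B) (U : T → D)
    (I : T → K) (hU : ∀ t u, F t = F u → G t = G u → U t = U u)
    (hF : ∀ t u, F t = F u → I t = I u) (hG : ∀ t u, G t = G u → I t = I u) :
    ∑ t, q t * (fiberMass q F t * fiberMass q G t / (fiberMass q U t * fiberMass q I t)) ≤
      ∑ t, q t := by
  classical
  have hU0 := fiberMass_nonneg hq U
  have hI0 := fiberMass_nonneg hq I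
  -- `U` is a function of the pair (`F`, `G`), so all contributing `t` lie in a single fibre of `U`.
  have inner : ∀ u v, ∑ t, (if F u = F t ∧ G v = G t then q t / fiberMass q U t else 0) ≤ 1 := by
    intro u v
    by_cases h : ∃ t₀, F u = F t₀ ∧ G v = G t₀
    · obtain ⟨t₀, h1, h2⟩ := h
      calc _ ≤ ∑ t, (if U t = U t₀ then q t else 0) / fiberMass q U t₀ := by
            refine Finset.sum_le_sum fun t _ => ?_
            by_cases h : F u = F t ∧ G v = G t
            · have e : U t = U t₀ := hU _ _ (h.1.symm.trans h1) (h.2.symm.trans h2)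
              simp [h, e, fiberMass_congr U e]
            · rw [if_neg h]
              refine div_nonneg ?_ (hU0 _)
              split_ifs <;> simp [hq]
        _ = fiberMass q U t₀ / fiberMass q U t₀ := by rw [← Finset.sum_div]; rfl
        _ ≤ 1 := div_self_le_one _
    · have : ∀ t, ¬ (F u = F t ∧ G v = G t) := fun t ht => h ⟨t, ht⟩
      simp [this]
  calc _ = ∑ t, ∑ u, ∑ v, q u * q v *
        (if F u = F t ∧ G v = G t then q t / fiberMass q U t / fiberMass q I t else 0) := by
        refine Finset.sum_congr rfl fun t _ => ?_
        have : q t * (fiberMass q F t * fiberMass q G t / (fiberMass q U t * fiberMass q I t)) =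
            fiberMass q F t * fiberMass q G t * (q t / fiberMass q U t / fiberMass q I t) := by
          rw [div_div]; ring
        rw [this]
        conv_lhs => simp only [fiberMass.eq_1 q F, fiberMass.eq_1 q G]
        rw [Finset.sum_mul_sum, Finset.sum_mul]
        refine Finset.sum_congr rfl fun u _ => ?_
        rw [Finset.sum_mul]
        refine Finset.sum_congr rfl fun v _ => ?_
        by_cases h1 : F u = F t <;> by_cases h2 : G v = G t <;> simp [h1, h2]
    _ = ∑ u, ∑ v, q u * q v * ∑ t,
        (if F u = F t ∧ G v = G t then q t / fiberMass q U t / fiberMass q I t else 0) := by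
        rw [Finset.sum_comm]
        refine Finset.sum_congr rfl fun u _ => ?_
        rw [Finset.sum_comm]
        refine Finset.sum_congr rfl fun v _ => ?_
        rw [Finset.mul_sum]
    -- `I` is a function of `F` and of `G`: a common `t` forces `I u = I t = I v`.
    _ ≤ ∑ u, ∑ v, q u * q v * (if I v = I u then 1 / fiberMass q I u else 0) := by
        refine Finset.sum_le_sum fun u _ => Finset.sum_le_sum fun v _ =>
          mul_le_mul_of_nonneg_left ?_ (mul_nonneg (hq u) (hq v))
        by_cases h : I v = I u
        · rw [if_pos h]
          calc _ = (∑ t, (if F u = F t ∧ G v = G t then q t / fiberMass q U t else 0)) /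
                fiberMass q I u := by
                rw [Finset.sum_div]
                refine Finset.sum_congr rfl fun t _ => ?_
                by_cases h : F u = F t ∧ G v = G t
                · simp [h, fiberMass_congr I (hF _ _ h.1)]
                · simp [h]
            _ ≤ _ := div_le_div_of_nonneg_right (inner u v) (hI0 u)
        · rw [if_neg h]
          refine le_of_eq (Finset.sum_eq_zero fun t _ => if_neg fun ht => h ?_)
          rw [hG _ _ ht.2, hF _ _ ht.1]
    _ = ∑ u, q u * (fiberMass q I u / fiberMass q I u) := by
        refine Finset.sum_congr rfl fun u _ => ?_
        have hc : ∑ v, (if I v = I u then q v else 0) = fiberMass q I u := rfl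
        generalize fiberMass q I u = c at hc ⊢
        rw [show c / c = (∑ v, if I v = I u then q v else 0) / c by rw [hc], Finset.sum_div,
          Finset.mul_sum]
        refine Finset.sum_congr rfl fun v _ => ?_
        split_ifs <;> simp [mul_assoc, div_eq_mul_inv]
    _ ≤ ∑ u, q u :=
        Finset.sum_le_sum fun u _ => mul_le_of_le_one_right (hq u) (div_self_le_one _)

/-- Apply log x ≤ x - 1 to the ratio in the double counting; points of mass zero drop out. For
restrictions to α, β, α ∪ β and α ∩ β this is submodularity, with signs reversed because entropy is
minus these sums. -/
theorem sum_log_fiberMass_submod (hq : ∀ t, 0 ≤ q t) (F : T → A) (G : T → B) (U : T → D)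
    (I : T → K) (hU : ∀ t u, F t = F u → G t = G u → U t = U u)
    (hF : ∀ t u, F t = F u → I t = I u) (hG : ∀ t u, G t = G u → I t = I u) :
    ∑ t, q t * Real.log (fiberMass q F t) + ∑ t, q t * Real.log (fiberMass q G t) ≤
      ∑ t, q t * Real.log (fiberMass q U t) + ∑ t, q t * Real.log (fiberMass q I t) := by
  have key := sum_mul_fiberMass_div_le hq F G U I hU hF hG
  have : ∀ t, q t * Real.log (fiberMass q F t) + q t * Real.log (fiberMass q G t) -
      (q t * Real.log (fiberMass q U t) + q t * Real.log (fiberMass q I t)) ≤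
      q t * (fiberMass q F t * fiberMass q G t / (fiberMass q U t * fiberMass q I t)) - q t := by
    intro t
    rcases (hq t).eq_or_lt with h | h
    · simp [← h]
    have f := h.trans_le (le_fiberMass hq F t)
    have g := h.trans_le (le_fiberMass hq G t)
    have u := h.trans_le (le_fiberMass hq U t)
    have i := h.trans_le (le_fiberMass hq I t)
    have l := Real.log_le_sub_one_of_pos (div_pos (mul_pos f g) (mul_pos u i))
    rw [Real.log_div (mul_pos f g).ne' (mul_pos u i).ne', Real.log_mul f.ne' g.ne',
      Real.log_mul u.ne' i.ne'] at l
    have := mul_le_mul_of_nonneg_left l h.le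
    linarith
  have := Finset.sum_le_sum fun t (_ : t ∈ Finset.univ) => this t
  simp only [Finset.sum_sub_distrib, Finset.sum_add_distrib] at this
  linarith

theorem sum_log_fiberMass_anti (hq : ∀ t, 0 ≤ q t) (F : T → A) (G : T → B)
    (h : ∀ t u, F t = F u → G t = G u) :
    ∑ t, q t * Real.log (fiberMass q F t) ≤ ∑ t, q t * Real.log (fiberMass q G t) := by
  refine Finset.sum_le_sum fun t _ => ?_
  rcases (hq t).eq_or_lt with h0 | h0
  · simp [← h0]
  · exact mul_le_mul_of_nonneg_left (Real.log_le_log (h0.trans_le (le_fiberMass hq F t))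
      (fiberMass_anti hq F G h t)) h0.le

end FiberMass

/-! ### Entropy functions are polymatroids -/

open Classical in
theorem PMF.toReal_map_apply_eq_sum {T A : Type*} [Fintype T] (p : PMF T) (F : T → A) (a : A) :
    (p.map F a).toReal = ∑ t, if F t = a then (p t).toReal else 0 := by
  rw [PMF.map_apply, tsum_fintype, ENNReal.toReal_sum]
  · refine Finset.sum_congr rfl fun t _ => ?_
    by_cases h : F t = a
    · simp [h]
    · simp [h, Ne.symm h]
  · intro t _
    split_ifs <;> simp [p.apply_ne_top]

/-- Only the law of `X` on the finite set `T` matters, whereas `Ω` may be infinite. -/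
theorem shannonEntropy_comp {Ω T A : Type*} [Fintype T] [Finite A] (p : PMF Ω) (X : Ω → T)
    (F : T → A) :
    shannonEntropy p (fun ω => F (X ω)) =
      -∑ t, (p.map X t).toReal * Real.log (fiberMass (fun t => (p.map X t).toReal) F t) := by
  classical
  have := Fintype.ofFinite A
  rw [← sum_negMulLog_fiber, shannonEntropy, tsum_fintype]
  refine Finset.sum_congr rfl fun a _ => ?_
  rw [← PMF.toReal_map_apply_eq_sum, PMF.map_comp]
  rfl

theorem entropyFunction_isPolymatroid {N Ω : Type*} [Finite N] {A : N → Type*}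
    [∀ i, Finite (A i)] (p : PMF Ω) (Y : ∀ i, Ω → A i) :
    IsPolymatroid (entropyFunction p Y) := by
  classical
  have := Fintype.ofFinite (∀ i, A i)
  let X : Ω → ∀ i, A i := fun ω i => Y i ω
  let q : (∀ i, A i) → ℝ := fun t => (p.map X t).toReal
  have hq : ∀ t, 0 ≤ q t := fun t => ENNReal.toReal_nonneg
  have h1 : ∑ t, q t = 1 := by
    have := (p.map X).tsum_coe
    rw [tsum_fintype] at this
    rw [← ENNReal.toReal_sum fun t _ => PMF.apply_ne_top _ t, this, ENNReal.toReal_one]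
  have key : ∀ α : Set N, entropyFunction p Y α =
      -∑ t, q t * Real.log (fiberMass q (fun (t : ∀ i, A i) (i : α) => t i) t) := fun α =>
    shannonEntropy_comp p X fun t (i : α) => t i
  have res : ∀ {α : Set N} {t u : ∀ i, A i},
      ((fun i : α => t i) = fun i : α => u i) ↔ ∀ i ∈ α, t i = u i := by
    intro α t u
    simp [funext_iff]
  refine ⟨?_, ?_, ?_⟩
  · rw [key]
    have : ∀ t, fiberMass q (fun (t : ∀ i, A i) (i : (∅ : Set N)) => t i) t = 1 := by
      intro t
      rw [← h1, fiberMass]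
      exact Finset.sum_congr rfl fun u _ => if_pos (res.2 (by simp))
    simp [this]
  · intro α β h
    rw [key, key, neg_le_neg_iff]
    exact sum_log_fiberMass_anti hq _ _ fun t u e => res.2 fun i hi => res.1 e i (h hi)
  · intro α β
    rw [key, key, key, key]
    have := sum_log_fiberMass_submod hq (fun (t : ∀ i, A i) (i : α) => t i)
      (fun (t : ∀ i, A i) (i : β) => t i) (fun (t : ∀ i, A i) (i : (α ∪ β : Set N)) => t i)
      (fun (t : ∀ i, A i) (i : (α ∩ β : Set N)) => t i)
      (fun t u e f => res.2 fun i hi => hi.elim (res.1 e i) (res.1 f i))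
      (fun t u e => res.2 fun i hi => res.1 e i hi.1)
      (fun t u e => res.2 fun i hi => res.1 e i hi.2)
    linarith

/-! ### The cone of almost entropic functions -/

theorem IsWeaklyEntropic.isPolymatroid {N : Type*} [Finite N] {h : RankFunction N}
    (hh : IsWeaklyEntropic h) : IsPolymatroid h := by
  obtain ⟨c, hc, Ω, p, A, _, Y, e⟩ := hh
  have H := entropyFunction_isPolymatroid p Y
  rw [← e] at H
  refine ⟨?_, ?_, ?_⟩
  · simpa [hc.ne'] using H.empty
  · intro α β hαβ
    exact le_of_mul_le_mul_left (H.mono hαβ) hc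
  · intro α β
    have := H.submod α β
    simp only [Pi.smul_apply, smul_eq_mul, ← mul_add] at this
    exact le_of_mul_le_mul_left this hc

theorem IsAlmostEntropic.isPolymatroid {N : Type*} [Finite N] {h : RankFunction N}
    (hh : IsAlmostEntropic h) : IsPolymatroid h := by
  obtain ⟨g, hg, hlim⟩ := hh
  rw [tendsto_pi_nhds] at hlim
  have H := fun n => (hg n).isPolymatroid
  refine ⟨?_, ?_, ?_⟩
  · exact tendsto_nhds_unique (hlim ∅) (by simp [(H _).empty])
  · intro α β hαβ
    exact le_of_tendsto_of_tendsto' (hlim α) (hlim β) fun n => (H n).mono hαβ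
  · intro α β
    exact le_of_tendsto_of_tendsto' ((hlim _).add (hlim _)) ((hlim _).add (hlim _))
      fun n => (H n).submod α β

theorem isAlmostEntropic_iff_mem_closure {N : Type*} [Finite N] {h : RankFunction N} :
    IsAlmostEntropic h ↔ h ∈ closure {g | IsWeaklyEntropic g} := by
  rw [mem_closure_iff_seq_limit]
  rfl

theorem isClosed_isAlmostEntropic {N : Type*} [Finite N] :
    IsClosed {h : RankFunction N | IsAlmostEntropic h} := by
  simp only [isAlmostEntropic_iff_mem_closure, Set.ofPred_mem_eq, isClosed_closure]

theorem IsAlmostEntropic.smul {N : Type*} {h : RankFunction N} (hh : IsAlmostEntropic h) {c : ℝ}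
    (hc : 0 < c) : IsAlmostEntropic (c • h) := by
  obtain ⟨g, hg, hlim⟩ := hh
  refine ⟨fun n => c • g n, fun n => ?_, hlim.const_smul c⟩
  obtain ⟨k, hk, H⟩ := hg n
  exact ⟨k / c, div_pos hk hc, by rwa [smul_smul, div_mul_cancel₀ _ hc.ne']⟩

theorem shannonEntropy_comp_injective {Ω A B : Type*} (p : PMF Ω) (X : Ω → A) {f : A → B}
    (hf : Function.Injective f) : shannonEntropy p (fun ω => f (X ω)) = shannonEntropy p X := by
  have hm : p.map (fun ω => f (X ω)) = (p.map X).map f := (PMF.map_comp X p f).symm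
  have happ : ∀ a, (p.map (fun ω => f (X ω))) (f a) = p.map X a := by
    intro a
    classical
    rw [hm, PMF.map_apply, tsum_eq_single a]
    · simp
    · intro b hb
      exact if_neg fun e => hb (hf e).symm
  rw [shannonEntropy, ← hf.tsum_eq]
  · simp [happ, shannonEntropy]
  · intro b hb
    by_contra hb'
    refine hb ?_
    have : (p.map (fun ω => f (X ω))) b = 0 := by
      rw [PMF.apply_eq_zero_iff, hm, PMF.support_map]
      exact fun h => hb' (Set.image_subset_range _ _ h)
    simp [this]

/-- `φ` need not be injective: repeating a variable adds no information, and a tuple over `φ '' α`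
is recovered from its pullback to `α`. -/
theorem entropyFunction_image {M N Ω : Type*} {A : N → Type*} (p : PMF Ω) (Y : ∀ i, Ω → A i)
    (φ : M → N) (α : Set M) :
    entropyFunction p Y (φ '' α) = entropyFunction p (fun i => Y (φ i)) α := by
  let f : (∀ i : φ '' α, A i) → ∀ i : α, A (φ i) := fun t i => t ⟨φ i, i, i.2, rfl⟩
  have hf : Function.Injective f := by
    intro t u e
    funext ⟨_, i, hi, rfl⟩
    exact congrFun e ⟨i, hi⟩
  exact (shannonEntropy_comp_injective p (fun ω (i : φ '' α) => Y i ω) hf).symm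

/-- This carries a rank function of the transformed network back to the original ground set. -/
theorem IsAlmostEntropic.comp_image {M N : Type*} {h : RankFunction N} (hh : IsAlmostEntropic h)
    (φ : M → N) : IsAlmostEntropic fun α => h (φ '' α) := by
  obtain ⟨g, hg, hlim⟩ := hh
  refine ⟨fun n α => g n (φ '' α), fun n => ?_, ?_⟩
  · obtain ⟨c, hc, Ω, p, A, hA, Y, e⟩ := hg n
    refine ⟨c, hc, Ω, p, fun i => A (φ i), fun i => hA _, fun i => Y (φ i), ?_⟩
    funext α
    rw [← entropyFunction_image, ← e]
    rfl
  · rw [tendsto_pi_nhds] at hlim ⊢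
    exact fun α => hlim _

/-! ### Functional dependence and independence in polymatroids -/

/-- `α` is a function of `β` as far as the rank function `h` can tell. -/
def RankFunction.Determined {N : Type*} (h : RankFunction N) (α β : Set N) : Prop :=
  h (α ∪ β) = h β

namespace IsPolymatroid

variable {N ι : Type*} {h : RankFunction N}

theorem nonneg (H : IsPolymatroid h) (α : Set N) : 0 ≤ h α :=
  H.empty ▸ H.mono (Set.empty_subset α)

theorem union_le (H : IsPolymatroid h) (α β : Set N) : h (α ∪ β) ≤ h α + h β := by
  linarith [H.submod α β, H.nonneg (α ∩ β)]

theorem image_le_sum (H : IsPolymatroid h) (x : ι → N) (J : Finset ι) :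
    h (x '' J) ≤ ∑ i ∈ J, h {x i} := by
  classical
  induction J using Finset.induction_on with
  | empty => simp [H.empty]
  | insert i J hi ih =>
    rw [Finset.sum_insert hi, Finset.coe_insert, Set.image_insert_eq, Set.insert_eq]
    linarith [H.union_le {x i} (x '' J)]

theorem range_le_sum [Fintype ι] (H : IsPolymatroid h) (x : ι → N) :
    h (Set.range x) ≤ ∑ i, h {x i} := by
  simpa using H.image_le_sum x Finset.univ

/-- If the rank of a family attains the sum of upper bounds for the singletons, the family and
all its subfamilies are independent. -/
theorem image_eq_sum [Fintype ι] (H : IsPolymatroid h) {x : ι → N} {w : ι → ℝ}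
    (hw : ∀ i, h {x i} ≤ w i) (hx : ∑ i, w i ≤ h (Set.range x)) (J : Finset ι) :
    h (x '' J) = ∑ i ∈ J, w i := by
  classical
  -- A deficit on `J` could not be made up on the complement, so the total would fall below the sum
  -- of all `w i`.
  have h1 := H.image_le_sum x J
  have h2 := H.image_le_sum x Jᶜ
  have h3 := H.union_le (x '' J) (x '' (Jᶜ : Finset ι))
  rw [← Set.image_union, ← Finset.coe_union, Finset.union_compl, Finset.coe_univ,
    Set.image_univ] at h3
  have h4 := Finset.sum_le_sum fun i (_ : i ∈ J) => hw i
  have h5 := Finset.sum_le_sum fun i (_ : i ∈ Jᶜ) => hw i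
  have h6 := Finset.sum_add_sum_compl J w
  linarith

theorem determined_of_le (H : IsPolymatroid h) {α β : Set N} (hle : h (α ∪ β) ≤ h β) :
    h.Determined α β :=
  le_antisymm hle (H.mono Set.subset_union_right)

theorem determined_of_subset {α β : Set N} (hαβ : α ⊆ β) : h.Determined α β := by
  rw [RankFunction.Determined, Set.union_eq_self_of_subset_left hαβ]

theorem determined_union (H : IsPolymatroid h) {α α' β : Set N} (h1 : h.Determined α β)
    (h2 : h.Determined α' β) : h.Determined (α ∪ α') β := by
  refine H.determined_of_le ?_
  have h3 := H.submod (α ∪ β) (α' ∪ β)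
  have h4 : h β ≤ h ((α ∪ β) ∩ (α' ∪ β)) :=
    H.mono (Set.subset_inter Set.subset_union_right Set.subset_union_right)
  rw [← Set.union_union_distrib_right, h1, h2] at h3
  linarith

theorem determined_trans (H : IsPolymatroid h) {α β γ : Set N} (h1 : h.Determined α β)
    (h2 : h.Determined β γ) : h.Determined α γ := by
  refine H.determined_of_le ?_
  have h3 := H.submod (α ∪ β) (β ∪ γ)
  have h4 : h β ≤ h ((α ∪ β) ∩ (β ∪ γ)) :=
    H.mono (Set.subset_inter Set.subset_union_right Set.subset_union_left)
  have h5 : h (α ∪ γ) ≤ h (α ∪ β ∪ (β ∪ γ)) := H.mono (by grind)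
  rw [h1, h2] at h3
  linarith

theorem determined_mono (H : IsPolymatroid h) {α β γ : Set N} (h1 : h.Determined α β)
    (h2 : β ⊆ γ) : h.Determined α γ :=
  H.determined_trans h1 (determined_of_subset h2)

theorem le_of_determined (H : IsPolymatroid h) {α β : Set N} (h1 : h.Determined α β) :
    h α ≤ h β :=
  (H.mono Set.subset_union_left).trans_eq h1

theorem determined_of_forall [Finite N] (H : IsPolymatroid h) {α β : Set N}
    (h1 : ∀ i ∈ α, h.Determined {i} β) : h.Determined α β := by
  induction α, α.toFinite using Set.Finite.induction_on with
  | empty => exact determined_of_subset (Set.empty_subset _)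
  | insert _ _ ih =>
    rw [Set.insert_eq]
    exact H.determined_union (h1 _ (Set.mem_insert _ _))
      (ih fun i hi => h1 i (Set.mem_insert_of_mem _ hi))

end IsPolymatroid

/-! ### Rank functions on the transformed network -/

namespace NetworkCodingProblem

variable {V E S : Type*} [Finite V] [Finite E] [Fintype S] {P : NetworkCodingProblem V E S}

theorem wellFounded_precedes (P : NetworkCodingProblem V E S) :
    WellFounded fun f g : E => P.tail g ∈ P.head f := by
  have : Std.Irrefl (Relation.TransGen fun f g : E => P.tail g ∈ P.head f) := ⟨P.acyclic⟩
  exact Subrelation.wf (fun {_ _} h => Relation.TransGen.single h)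
    (Finite.wellFounded_of_trans_of_irrefl
      (Relation.TransGen fun f g : E => P.tail g ∈ P.head f))

/-- The edges of the transformed network which carry the messages of the original one. -/
def daggerEmbed (P : NetworkCodingProblem V E S) : S ⊕ E → Fin 2 ⊕ P.DaggerEdge :=
  Sum.elim (fun s => .inr (.a s)) (fun e => .inr (.orig e))

section Incoming

variable (P : NetworkCodingProblem V E S)

/-- The edge `a_s` as an element of the ground set. -/
abbrev edgeA (s : S) : Fin 2 ⊕ P.DaggerEdge := .inr (.a s)

/-- The edge `b_s` as an element of the ground set. -/
abbrev edgeB (s : S) : Fin 2 ⊕ P.DaggerEdge := .inr (.b s)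

/-- The edge `c_s` as an element of the ground set. -/
abbrev edgeC (s : S) : Fin 2 ⊕ P.DaggerEdge := .inr (.c s)

/-- The edge `d_{s,u}` as an element of the ground set. -/
abbrev edgeD (s : S) (u : P.sinks s) : Fin 2 ⊕ P.DaggerEdge := .inr (.d s u)

/-- An original node sees exactly what it saw before, with a_s in place of source s; this lets the
coding and decoding constraints pass between the two problems. -/
theorem dagger_incoming_orig (v : V) :
    P.dagger.incoming (.orig v) = P.daggerEmbed '' P.incoming v := by
  ext f
  rcases f with i | e | s | s | s | ⟨s, u⟩ <;>
    simp [incoming, dagger, daggerHead, daggerEmbed]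

theorem dagger_incoming_gamma (s : S) :
    P.dagger.incoming (.gamma s) = {P.edgeA s, P.edgeB s} := by
  ext f
  rcases f with i | e | s | s | s | ⟨s, u⟩ <;>
    simp [incoming, dagger, daggerHead, eq_comm]

theorem dagger_incoming_psi : P.dagger.incoming .psi = Set.range P.edgeB := by
  ext f
  rcases f with i | e | s | s | s | ⟨s, u⟩ <;>
    simp [incoming, dagger, daggerHead]

theorem dagger_incoming_phi : P.dagger.incoming .phi = Set.range Sum.inl := by
  ext f
  rcases f with i | e | s | s | s | ⟨s, u⟩ <;>
    simp [incoming, dagger, daggerHead]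

theorem dagger_incoming_eta :
    P.dagger.incoming .eta = Set.range P.edgeB ∪ Set.range P.edgeC := by
  ext f
  rcases f with i | e | s | s | s | ⟨s, u⟩ <;>
    simp [incoming, dagger, daggerHead]

theorem dagger_incoming_etaStar :
    P.dagger.incoming .etaStar = Set.range P.edgeA ∪ Set.range P.edgeC := by
  ext f
  rcases f with i | e | s | s | s | ⟨s, u⟩ <;>
    simp [incoming, dagger, daggerHead]

theorem dagger_incoming_tau (s : S) (u : P.sinks s) :
    P.dagger.incoming (.tau s u) = P.edgeB '' {s}ᶜ ∪ {P.edgeC s, P.edgeD s u} := by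
  ext f
  rcases f with i | e | s' | s' | s' | ⟨s', u'⟩
  · simp [incoming, dagger]
  · simp [incoming, dagger, daggerHead]
  · simp [incoming, dagger, daggerHead]
  · constructor
    · rintro (h | ⟨j, hj, v, h⟩)
      · simp at h
      · cases h
        exact .inl ⟨s', hj.symm, rfl⟩
    · rintro (⟨_, hne, h⟩ | h)
      · cases h
        exact .inr ⟨s, Ne.symm hne, u, rfl⟩
      · simp at h
  · simp [incoming, dagger, daggerHead]
    grind
  · simp [incoming, dagger, daggerHead]
    grind

end Incoming

section Polymatroid

variable {h : RankFunction (Fin 2 ⊕ P.DaggerEdge)} {t : Tuple E S}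

/-- Every original edge is a function of the messages `a_s`. -/
theorem determined_range_edgeA (H : IsPolymatroid h) (hT : h ∈ P.dagger.CT) (e : E) :
    h.Determined {Sum.inr (.orig e)} (Set.range P.edgeA) := by
  induction e using P.wellFounded_precedes.induction with
  | _ e ih =>
  refine H.determined_trans (sub_eq_zero.1 (hT (.orig e))) ?_
  refine H.determined_of_forall ?_
  change ∀ i ∈ P.dagger.incoming (.orig (P.tail e)), _
  rw [dagger_incoming_orig]
  rintro _ ⟨s | f, hf, rfl⟩
  · exact IsPolymatroid.determined_of_subset (by simp [daggerEmbed])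
  · exact ih f hf

/-- The layer `b`, `c` carries both sources, hence so does the layer `a`, `b`, and the messages in
each of the layers are independent. -/
theorem two_mul_sum_le (H : IsPolymatroid h) (hI : h ∈ P.dagger.CI) (hD : h ∈ P.dagger.CD)
    (hS : ∀ i, ∑ s, t.1 s ≤ h {Sum.inl i}) :
    ∑ s, t.1 s + ∑ s, t.1 s ≤ h (Set.range P.edgeB ∪ Set.range P.edgeC) := by
  have h1 : h (Set.range Sum.inl) = ∑ i, h {Sum.inl i} := hI
  rw [Fin.sum_univ_two] at h1
  have h2 : h.Determined (Set.range Sum.inl) (Set.range P.edgeB ∪ Set.range P.edgeC) := by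
    refine H.determined_of_forall ?_
    rintro _ ⟨i, rfl⟩
    rw [← dagger_incoming_eta]
    exact sub_eq_zero.1 (hD i .eta (by fin_cases i <;> simp [dagger]))
  linarith [H.le_of_determined h2, hS 0, hS 1]

theorem determined_edgeC (hT : h ∈ P.dagger.CT) (s : S) :
    h.Determined {P.edgeC s} {P.edgeA s, P.edgeB s} := by
  rw [← dagger_incoming_gamma]
  exact sub_eq_zero.1 (hT (.c s))

theorem two_mul_sum_le' (H : IsPolymatroid h) (hI : h ∈ P.dagger.CI) (hT : h ∈ P.dagger.CT)
    (hD : h ∈ P.dagger.CD) (hS : ∀ i, ∑ s, t.1 s ≤ h {Sum.inl i}) :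
    ∑ s, t.1 s + ∑ s, t.1 s ≤ h (Set.range P.edgeA ∪ Set.range P.edgeB) := by
  refine (two_mul_sum_le H hI hD hS).trans (H.le_of_determined ?_)
  refine H.determined_union
    (IsPolymatroid.determined_of_subset Set.subset_union_right) (H.determined_of_forall ?_)
  rintro _ ⟨s, rfl⟩
  refine H.determined_mono (determined_edgeC hT s) ?_
  rintro _ (rfl | rfl) <;> simp

/-- Both layers are treated as one family over `S ⊕ S`, whose total rank already attains the sum of
the capacities. -/
theorem eq_sum_of_layer (H : IsPolymatroid h) {x y : S → Fin 2 ⊕ P.DaggerEdge}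
    (hx : ∀ s, h {x s} ≤ t.1 s) (hy : ∀ s, h {y s} ≤ t.1 s)
    (hxy : ∑ s, t.1 s + ∑ s, t.1 s ≤ h (Set.range x ∪ Set.range y)) (J K : Finset S) :
    h (x '' J ∪ y '' K) = ∑ s ∈ J, t.1 s + ∑ s ∈ K, t.1 s := by
  have := H.image_eq_sum (x := Sum.elim x y) (w := Sum.elim t.1 t.1)
    (by rintro (s | s); exacts [hx s, hy s]) (by simpa using hxy) (J.disjSum K)
  rw [Finset.sum_disjSum] at this
  rw [← show Sum.elim x y '' (J.disjSum K : Finset (S ⊕ S)) = x '' J ∪ y '' K by ext; simp]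
  exact this

/-- In the transformed problem `a_s` can be recovered at every sink of `s`. -/
theorem determined_edgeA (H : IsPolymatroid h) (hI : h ∈ P.dagger.CI) (hT : h ∈ P.dagger.CT)
    (hD : h ∈ P.dagger.CD) (hS : ∀ i, ∑ s, t.1 s ≤ h {Sum.inl i})
    (hE : ∀ e, h {Sum.inr e} ≤ (P.daggerTuple t).2 e) (s : S) (u : P.sinks s) :
    h.Determined {P.edgeA s} (P.dagger.incoming (.orig u)) := by
  classical
  have hbc := eq_sum_of_layer H (fun s => hE (.b s)) (fun s => hE (.c s))
    (two_mul_sum_le H hI hD hS)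
  have hab := eq_sum_of_layer H (fun s => hE (.a s)) (fun s => hE (.b s))
    (two_mul_sum_le' H hI hT hD hS)
  have hA : h (Set.range P.edgeA) = ∑ s, t.1 s := by simpa using hab Finset.univ ∅
  have hB : h (Set.range P.edgeB) = ∑ s, t.1 s := by simpa using hab ∅ Finset.univ
  have hBa : h ({P.edgeA s} ∪ Set.range P.edgeB) = t.1 s + ∑ s, t.1 s := by
    simpa using hab {s} Finset.univ
  have hBc : h (Set.range P.edgeB ∪ {P.edgeC s}) = ∑ s, t.1 s + t.1 s := by
    simpa using hbc Finset.univ {s}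
  -- the messages `b` determine the first source and conversely
  have h1B : h.Determined {Sum.inl 0} (Set.range P.edgeB) := by
    rw [← dagger_incoming_psi]
    exact sub_eq_zero.1 (hD 0 .psi (by simp [dagger]))
  -- The b's have total rank Λ, no more than the rank of the source 1' they determine.
  have hB1 : h.Determined (Set.range P.edgeB) {Sum.inl 0} := by
    refine H.determined_of_le ?_
    rw [Set.union_comm, h1B, hB]
    exact hS 0
  -- the sink `tau s u`
  set W : Set (Fin 2 ⊕ P.DaggerEdge) := P.edgeB '' {s}ᶜ ∪ {P.edgeC s, P.edgeD s u} with hW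
  have h1W : h.Determined {Sum.inl 0} W := by
    rw [hW, ← dagger_incoming_tau]
    exact sub_eq_zero.1 (hD 0 (.tau s u) (by simp [dagger]))
  -- Decoding 1' at this sink gives back b_s, the one b-message absent from `W`.
  have hBcW : h.Determined (Set.range P.edgeB ∪ {P.edgeC s}) W :=
    H.determined_union (H.determined_trans hB1 h1W)
      (IsPolymatroid.determined_of_subset (by simp [hW]))
  have hWle : h W ≤ ∑ s, t.1 s + h {P.edgeD s u} := by
    have h1 : h (P.edgeB '' {s}ᶜ ∪ {P.edgeC s}) = ∑ s ∈ {s}ᶜ, t.1 s + t.1 s := by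
      simpa using hbc {s}ᶜ {s}
    have h2 := H.union_le (P.edgeB '' {s}ᶜ ∪ {P.edgeC s}) {P.edgeD s u}
    have h3 := Finset.sum_compl_add_sum {s} t.1
    rw [Set.union_assoc, ← Set.insert_eq, ← hW] at h2
    rw [Finset.sum_singleton] at h3
    linarith
  -- The b's and c_s, of rank Λ + λ(s), are functions of `W`, and the part of `W` other than d has
  -- rank Λ.
  have hd : t.1 s ≤ h {P.edgeD s u} := by
    linarith [H.le_of_determined hBcW]
  have hd' : h {P.edgeD s u} ≤ t.1 s := hE (.d s u)
  -- `W` has no rank beyond that of the b's and c_s, which it determines, so d inside `W` is in turn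
  -- a function of them.
  have hdBc : h.Determined {P.edgeD s u} (Set.range P.edgeB ∪ {P.edgeC s}) := by
    refine H.determined_of_le ((H.mono ?_).trans (hBcW.le.trans (hWle.trans ?_)))
    · rw [hW]
      rintro _ (rfl | hx)
      · simp
      · exact .inl hx
    · linarith
  have hdBa : h.Determined {P.edgeD s u} ({P.edgeA s} ∪ Set.range P.edgeB) := by
    refine H.determined_trans hdBc (H.determined_union
      (IsPolymatroid.determined_of_subset Set.subset_union_right)
      (H.determined_mono (determined_edgeC hT s) ?_))
    rintro _ (rfl | rfl) <;> simp
  have hdu : h.Determined {P.edgeD s u} (P.dagger.incoming (.orig u)) :=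
    sub_eq_zero.1 (hT (.d s u))
  have hdA : h.Determined {P.edgeD s u} (Set.range P.edgeA) := by
    refine H.determined_trans hdu (H.determined_of_forall ?_)
    rw [dagger_incoming_orig]
    rintro _ ⟨s | f, -, rfl⟩
    · exact IsPolymatroid.determined_of_subset (by simp [daggerEmbed])
    · exact determined_range_edgeA H hT f
  refine H.determined_trans (H.determined_of_le ?_) hdu
  -- The two sets have ranks Λ and λ(s) + Λ and their union at least 2Λ, so the intersection, which
  -- contains a_s and d, has rank at most λ(s) ≤ h(d).
  have h1 := H.submod ({P.edgeD s u} ∪ Set.range P.edgeA)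
    ({P.edgeD s u} ∪ ({P.edgeA s} ∪ Set.range P.edgeB))
  have h2 : h (Set.range P.edgeA ∪ Set.range P.edgeB) ≤ h (({P.edgeD s u} ∪ Set.range P.edgeA) ∪
    ({P.edgeD s u} ∪ ({P.edgeA s} ∪ Set.range P.edgeB))) := H.mono (by grind)
  have h3 : h ({P.edgeA s} ∪ {P.edgeD s u}) ≤ h (({P.edgeD s u} ∪ Set.range P.edgeA) ∩
    ({P.edgeD s u} ∪ ({P.edgeA s} ∪ Set.range P.edgeB))) := by
    refine H.mono ?_
    rintro _ (rfl | rfl) <;> simp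
  rw [hdA, hdBa, hA, hBa] at h1
  linarith [two_mul_sum_le' H hI hT hD hS]

end Polymatroid

/-! ### The outer bound -/

/-- A tuple in the outer bound is dominated by the projection of a single almost entropic
function, since the rank functions in question form a closed cone and are bounded by the rates of
the singletons. -/
theorem exists_of_mem_yeungOuterBound {t : Tuple E S} (ht : t ∈ P.yeungOuterBound) :
    ∃ h, IsAlmostEntropic h ∧ h ∈ P.CI ∧ h ∈ P.CT ∧ h ∈ P.CD ∧ (∀ s, t.1 s ≤ h {Sum.inl s}) ∧
      ∀ e, h {Sum.inr e} ≤ t.2 e := by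
  have := Fintype.ofFinite E
  obtain ⟨-, r, c, hr, hc, hE, hS⟩ := ht
  choose h hh hhr using hr
  obtain rfl : (fun n => P.proj (h n)) = r := funext hhr
  choose lE hlE hlE' using hE
  choose lS hlS hlS' using hS
  let g : ℕ → RankFunction (S ⊕ E) := fun n => c n • h n
  have hg : ∀ n, IsAlmostEntropic (g n) := fun n => (hh n).1.1.1.smul (hc n)
  have hlim : ∀ f, Tendsto (fun n => g n {f}) atTop (𝓝 (Sum.elim lS lE f)) := by
    rintro (s | e)
    exacts [hlS s, hlE e]
  have hsum : Tendsto (fun n => ∑ f, g n {f}) atTop (𝓝 (∑ f, Sum.elim lS lE f)) :=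
    tendsto_finsetSum _ fun f _ => hlim f
  obtain ⟨M, hM⟩ := hsum.bddAbove_range
  have hmem : ∀ n, g n ∈ Set.Icc (fun _ : Set (S ⊕ E) => (0 : ℝ)) fun _ => M := by
    intro n
    have H := (hg n).isPolymatroid
    refine ⟨fun α => H.nonneg α, fun α => ?_⟩
    calc g n α ≤ g n (Set.range id) := H.mono (by simp)
      _ ≤ ∑ f, g n {f} := H.range_le_sum id
      _ ≤ M := hM ⟨n, rfl⟩
  -- Only singleton ranks are known to converge; the others are bounded and converge along a
  -- subsequence. The constraints are linear and survive the limit.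
  obtain ⟨k, -, σ, hσ, hk⟩ := isCompact_Icc.tendsto_subseq hmem
  have hk' := tendsto_pi_nhds.1 hk
  have hval : ∀ f, k {f} = Sum.elim lS lE f := fun f =>
    tendsto_nhds_unique (hk' {f}) ((hlim f).comp hσ.tendsto_atTop)
  refine ⟨k, isClosed_isAlmostEntropic.mem_of_tendsto hk (.of_forall fun n => hg _), ?_, ?_, ?_,
    fun s => by simpa [hval] using hlS' s, fun e => by simpa [hval] using hlE' e⟩
  · refine tendsto_nhds_unique (hk' _) ?_
    refine (tendsto_finsetSum _ fun s _ => hk' {Sum.inl s}).congr fun n => ?_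
    have : h (σ n) (Set.range Sum.inl) = ∑ s, h (σ n) {Sum.inl s} := (hh (σ n)).1.1.2
    simp [g, this, Finset.mul_sum]
  · intro e
    refine tendsto_nhds_unique ((hk' _).sub (hk' _)) (tendsto_const_nhds.congr fun n => ?_)
    have : _ - _ = (0 : ℝ) := (hh (σ n)).1.2 e
    change (0 : ℝ) = c (σ n) * _ - c (σ n) * _
    rw [← mul_sub, this, mul_zero]
  · intro s u hu
    refine tendsto_nhds_unique ((hk' _).sub (hk' _)) (tendsto_const_nhds.congr fun n => ?_)
    have : _ - _ = (0 : ℝ) := (hh (σ n)).2 s u hu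
    change (0 : ℝ) = c (σ n) * _ - c (σ n) * _
    rw [← mul_sub, this, mul_zero]

/-- The message a_s takes the role of Y_s. Its rank is exactly λ(s), so independence of the a's is
source independence, and a constant sequence suffices. -/
theorem mem_yeungOuterBound_of_dagger {t : Tuple E S} (ht : t ∈ P.rateCapacityTuples)
    (hd : P.daggerTuple t ∈ P.dagger.yeungOuterBound) : t ∈ P.yeungOuterBound := by
  classical
  obtain ⟨h, hae, hI, hT, hD, hS, hE⟩ := exists_of_mem_yeungOuterBound hd
  have H := hae.isPolymatroid
  have hab := eq_sum_of_layer H (fun s => hE (.a s)) (fun s => hE (.b s))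
    (two_mul_sum_le' H hI hT hD hS)
  have hA : ∀ s, h {P.edgeA s} = t.1 s := fun s => by simpa using hab {s} ∅
  let g : RankFunction (S ⊕ E) := fun α => h (P.daggerEmbed '' α)
  have gs : ∀ s, g {Sum.inl s} = t.1 s := fun s => by simpa [g, daggerEmbed] using hA s
  have ge : ∀ e, g {Sum.inr e} ≤ t.2 e := fun e => by
    have : h {Sum.inr (.orig e)} ≤ t.2 e := hE (.orig e)
    simpa [g, daggerEmbed] using this
  have gcond : ∀ f v, h.Determined {P.daggerEmbed f} (P.dagger.incoming (.orig v)) →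
      g.cond {f} (P.incoming v) = 0 := by
    intro f v hf
    rw [dagger_incoming_orig] at hf
    simp only [RankFunction.cond, g, Set.image_union, Set.image_singleton]
    exact sub_eq_zero.2 hf
  refine ⟨ht, fun _ => P.proj g, fun _ => 1, fun _ => ⟨g, ⟨⟨⟨hae.comp_image _, ?_⟩, ?_⟩, ?_⟩, rfl⟩,
    fun _ => one_pos, fun e => ⟨_, tendsto_const_nhds, ?_⟩, fun s => ⟨_, tendsto_const_nhds, ?_⟩⟩
  · change g _ = ∑ s, g _
    simp only [gs]
    have := hab Finset.univ ∅
    simp only [Finset.coe_univ, Set.image_univ, Finset.coe_empty, Set.image_empty, Set.union_empty,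
      Finset.sum_empty, add_zero] at this
    rw [← this]
    simp only [g, ← Set.range_comp]
    rfl
  · exact fun e => gcond (.inr e) _ (sub_eq_zero.1 (hT (.orig e)))
  · exact fun s u hu => gcond (.inl s) u (determined_edgeA H hI hT hD hS hE s ⟨u, hu⟩)
  · simpa [proj] using ge e
  · simp [proj, gs]

end NetworkCodingProblem

/-! ### Network codes from uniformly distributed messages -/

theorem PMF.map_uniformOfFintype_equiv {A B : Type*} [Fintype A] [Nonempty A] [Fintype B]
    [Nonempty B] (e : A ≃ B) :
    (PMF.uniformOfFintype A).map e = PMF.uniformOfFintype B := by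
  classical
  ext b
  rw [PMF.map_apply, tsum_eq_single (e.symm b)]
  · simp [Fintype.card_congr e]
  · intro a ha
    exact if_neg fun h => ha (by simp [h])

theorem PMF.map_fst_uniformOfFintype {A R : Type*} [Fintype A] [Nonempty A] [Fintype R]
    [Nonempty R] :
    (PMF.uniformOfFintype (A × R)).map Prod.fst = PMF.uniformOfFintype A := by
  classical
  ext a
  rw [PMF.map_apply, tsum_fintype, Fintype.sum_prod_type, Finset.sum_comm]
  simp only [PMF.uniformOfFintype_apply, Fintype.card_prod, Nat.cast_mul, Finset.sum_ite_eq,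
    Finset.mem_univ, if_true, Finset.sum_const, Finset.card_univ, nsmul_eq_mul]
  rw [ENNReal.mul_inv (.inr (ENNReal.natCast_ne_top _)) (.inl (ENNReal.natCast_ne_top _)),
    mul_left_comm, ENNReal.mul_inv_cancel (by simp) (ENNReal.natCast_ne_top _), mul_one]

theorem PMF.map_eval_uniformOfFintype {S : Type*} [Fintype S] {A : S → Type*} [∀ s, Fintype (A s)]
    [∀ s, Nonempty (A s)] [Fintype (∀ s, A s)] (s : S) :
    (PMF.uniformOfFintype (∀ s, A s)).map (fun y => y s) = PMF.uniformOfFintype (A s) := by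
  classical
  rw [← PMF.map_fst_uniformOfFintype (A := A s) (R := ∀ j : {j // j ≠ s}, A j),
    ← PMF.map_uniformOfFintype_equiv (Equiv.piSplitAt s A), PMF.map_comp]
  rfl

namespace NetworkCodingProblem

variable {V E S : Type*} [Finite V] [Finite E] [Fintype S] {P : NetworkCodingProblem V E S}

/-- A deterministic zero-error scheme, in which the joint source message runs through all values
exactly once, is a zero-error network code. -/
theorem exists_networkCode {Ω : Type*} [Finite Ω] [Nonempty Ω] {A : S ⊕ E → Type}
    [hA : ∀ f, Finite (A f)] (Y : ∀ f, Ω → A f)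
    (hsrc : Function.Bijective fun ω (s : S) => Y (.inl s) ω)
    (henc : ∀ e ω ω', (∀ f ∈ P.incoming (P.tail e), Y f ω = Y f ω') →
      Y (.inr e) ω = Y (.inr e) ω')
    (hdec : ∀ s, ∀ u ∈ P.sinks s, ∀ ω ω', (∀ f ∈ P.incoming u, Y f ω = Y f ω') →
      Y (.inl s) ω = Y (.inl s) ω') :
    ∃ C : P.NetworkCode, C.ZeroError ∧
      ∀ f, C.logSupport f = Real.log ((Set.range (Y f)).ncard : ℝ) := by
  classical
  have := Fintype.ofFinite Ω
  have := fun f => Fintype.ofFinite (A f)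
  have hne : ∀ f, Nonempty (A f) := fun f => ‹Nonempty Ω›.map (Y f)
  -- `Ω` may live in any universe, but the sample space of a code must lie in `Type`.
  let ε := equivShrink.{0} Ω
  have : Fintype (Shrink.{0} Ω) := .ofEquiv Ω ε
  have : Nonempty (Shrink.{0} Ω) := ‹Nonempty Ω›.map ε
  let Z : ∀ f, Shrink.{0} Ω → A f := fun f ω => Y f (ε.symm ω)
  let p := PMF.uniformOfFintype (Shrink.{0} Ω)
  -- Reading off the sources identifies the sample space with the product of their alphabets;
  -- uniformity and independence both follow.
  let σ : Shrink.{0} Ω ≃ ∀ s, A (.inl s) := ε.symm.trans (Equiv.ofBijective _ hsrc)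
  have hσ : p.map σ = PMF.uniformOfFintype _ := PMF.map_uniformOfFintype_equiv σ
  have hmarg : ∀ s, p.map (Z (.inl s)) = PMF.uniformOfFintype _ := fun s => by
    rw [← PMF.map_eval_uniformOfFintype (A := fun s => A (.inl s)) s, ← hσ, PMF.map_comp]
    rfl
  have hfac : ∀ (u : V) (f : S ⊕ E), (∀ ω ω', (∀ g ∈ P.incoming u, Y g ω = Y g ω') →
      Y f ω = Y f ω') → ∃ φ : (∀ g : P.incoming u, A g) → A f, ∀ ω, Z f ω = φ fun g => Z g ω := by
    intro u f h
    have : (Z f).FactorsThrough fun ω (g : P.incoming u) => Z g ω := fun ω ω' e =>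
      h _ _ fun g hg => congrFun e ⟨g, hg⟩
    obtain ⟨φ, hφ⟩ := (Function.factorsThrough_iff _).1 this
    exact ⟨φ, congrFun hφ⟩
  choose φ hφ using fun e => hfac (P.tail e) (.inr e) (henc e)
  refine ⟨{ Alphabet := A, finite_alphabet := hA, encoder := φ, Ω := Shrink.{0} Ω, prob := p,
            Y := Z, uniform := ?_, indep := ?_, encode := fun ω _ e => hφ e ω }, ?_, ?_⟩
  · intro s y _ y' _
    rw [hmarg]
    simp
  · intro y
    simp only [hmarg]
    change p.map σ y = _
    rw [hσ]
    simp only [PMF.uniformOfFintype_apply, Fintype.card_pi, Nat.cast_prod]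
    rw [ENNReal.prod_inv_distrib]
    intro i _ j _ _
    exact .inr (ENNReal.natCast_ne_top _)
  · intro s u hu
    obtain ⟨g, hg⟩ := hfac u (.inl s) (hdec s u hu)
    exact ⟨g, fun ω _ => hg ω⟩
  · intro f
    have : (p.map (Z f)).support = Set.range (Y f) := by
      rw [PMF.support_map, PMF.support_uniformOfFintype, Set.top_eq_univ, Set.image_univ]
      exact ε.symm.surjective.range_comp (Y f)
    simp only [NetworkCode.logSupport, this]

/-- Every tuple of source messages in the supports occurs with positive probability. -/
theorem NetworkCode.exists_mem_support (C : P.NetworkCode)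
    (y : ∀ s, (C.prob.map (C.Y (.inl s))).support) :
    ∃ ω ∈ C.prob.support, ∀ s, C.Y (.inl s) ω = y s := by
  have h : (fun s => (y s : C.Alphabet (.inl s))) ∈
      (C.prob.map fun ω s => C.Y (.inl s) ω).support := by
    rw [PMF.mem_support_iff, C.indep]
    exact Finset.prod_ne_zero_iff.2 fun s _ => (y s).2
  rw [PMF.support_map] at h
  obtain ⟨ω, hω, h⟩ := h
  exact ⟨ω, hω, congrFun h⟩

/-- The two-layer scheme: `2'` consists of the messages `a_s`, which are encoded by `k` independent
uses of a code for the original problem, `1'` consists of one-time pads `b_s`, and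
`c_s = a_s + b_s`. -/
theorem NetworkCode.exists_dagger (C : P.NetworkCode) (hC : C.ZeroError) (k : ℕ) {G : S → Type}
    [∀ s, AddCommGroup (G s)] [∀ s, Finite (G s)]
    (ι : ∀ s, G s → Fin k → (C.prob.map (C.Y (.inl s))).support)
    (hι : ∀ s, Function.Injective (ι s)) :
    ∃ D : P.dagger.NetworkCode, D.ZeroError ∧
      (∀ i, D.logSupport (.inl i) = ∑ s, Real.log (Nat.card (G s))) ∧
      (∀ s, D.logSupport (.inr (.a s)) = Real.log (Nat.card (G s))) ∧
      (∀ s, D.logSupport (.inr (.b s)) = Real.log (Nat.card (G s))) ∧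
      (∀ s, D.logSupport (.inr (.c s)) = Real.log (Nat.card (G s))) ∧
      (∀ s u, D.logSupport (.inr (.d s u)) = Real.log (Nat.card (G s))) ∧
      ∀ e, D.logSupport (.inr (.orig e)) ≤ k * C.logSupport (.inr e) := by
  classical
  have := C.finite_alphabet
  choose τ hτ hτY using C.exists_mem_support
  -- The i-th use of the code feeds in the i-th letter of each encoded message; `τ` supplies an
  -- outcome of positive probability, where the code's identities hold.
  let word : ∀ f, (∀ s, G s) → Fin k → C.Alphabet f := fun f x i => C.Y f (τ fun s => ι s (x s) i)
  have word_inl : ∀ s x i, word (.inl s) x i = ι s (x s) i := fun s x i => hτY _ s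
  have word_inl_iff : ∀ s x x', word (.inl s) x = word (.inl s) x' ↔ x s = x' s := by
    intro s x x'
    refine ⟨fun h => hι s (funext fun i => Subtype.ext ?_), fun h => funext fun i => ?_⟩
    · rw [← word_inl, ← word_inl, h]
    · rw [word_inl, word_inl, h]
  let A : Fin 2 ⊕ P.DaggerEdge → Type
    | .inl _ => Shrink.{0} (∀ s, G s)
    | .inr (.orig e) => Fin k → C.Alphabet (.inr e)
    | .inr (.a s) => G s
    | .inr (.b s) => G s
    | .inr (.c s) => G s
    | .inr (.d s _) => G s
  have hA : ∀ f, Finite (A f) := by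
    rintro (i | e | s | s | s | ⟨s, u⟩)
    · exact Finite.of_equiv _ (equivShrink.{0} (∀ s, G s))
    all_goals dsimp only [A]; infer_instance
  -- Coordinate `0` is the pad 1' and coordinate `1` the message 2'.
  let Y : ∀ f, (Fin 2 → ∀ s, G s) → A f
    | .inl i => fun ω => equivShrink _ (ω i)
    | .inr (.orig e) => fun ω => word (.inr e) (ω 1)
    | .inr (.a s) => fun ω => ω 1 s
    | .inr (.b s) => fun ω => ω 0 s
    | .inr (.c s) => fun ω => ω 1 s + ω 0 s
    | .inr (.d s _) => fun ω => ω 1 s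
  have hword : ∀ v (ω ω' : Fin 2 → ∀ s, G s),
      (∀ f ∈ P.dagger.incoming (.orig v), Y f ω = Y f ω') →
      ∀ f ∈ P.incoming v, word f (ω 1) = word f (ω' 1) := by
    intro v ω ω' h f hf
    rw [dagger_incoming_orig] at h
    have := h _ (Set.mem_image_of_mem _ hf)
    rcases f with s | e
    · exact (word_inl_iff s _ _).2 this
    · exact this
  have hY : ∀ i ω ω', ω i = ω' i → Y (.inl i) ω = Y (.inl i) ω' := fun i ω ω' h =>
    congrArg (equivShrink _) h
  have key : ∃ D : P.dagger.NetworkCode, D.ZeroError ∧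
      ∀ f, D.logSupport f = Real.log ((Set.range (Y f)).ncard : ℝ) := by
    refine exists_networkCode Y ?_ ?_ ?_
    · refine ⟨fun ω ω' h => funext fun i => (equivShrink _).injective (congrFun h i), fun y => ?_⟩
      exact ⟨fun i => (equivShrink _).symm (y i), by simp [Y]⟩
    · rintro (e | s | s | s | ⟨s, u⟩) ω ω' h
      · funext i
        change C.Y _ _ = C.Y _ _
        rw [C.encode _ (hτ _), C.encode _ (hτ _)]
        congr 1
        funext f
        exact congrFun (hword _ ω ω' h f f.2) i
      · change ∀ f ∈ P.dagger.incoming .phi, _ at h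
        rw [dagger_incoming_phi] at h
        exact congrFun ((equivShrink _).injective (h _ ⟨1, rfl⟩)) s
      · change ∀ f ∈ P.dagger.incoming .phi, _ at h
        rw [dagger_incoming_phi] at h
        exact congrFun ((equivShrink _).injective (h _ ⟨0, rfl⟩)) s
      · change ∀ f ∈ P.dagger.incoming (.gamma s), _ at h
        rw [dagger_incoming_gamma] at h
        exact congrArg₂ (· + ·) (h _ (.inl rfl)) (h _ (.inr rfl))
      · change ∀ f ∈ P.dagger.incoming (.orig u), _ at h
        obtain ⟨g, hg⟩ := hC s u u.2
        refine (word_inl_iff s _ _).1 (funext fun i => ?_)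
        change C.Y _ _ = C.Y _ _
        rw [hg _ (hτ _), hg _ (hτ _)]
        congr 1
        funext f
        exact congrFun (hword _ ω ω' h f f.2) i
    · have heta : ∀ ω ω', (∀ f ∈ P.dagger.incoming .eta, Y f ω = Y f ω') → ω = ω' := by
        intro ω ω' h
        rw [dagger_incoming_eta] at h
        have hb : ∀ s, ω 0 s = ω' 0 s := fun s => h _ (.inl ⟨s, rfl⟩)
        have hc : ∀ s, ω 1 s + ω 0 s = ω' 1 s + ω' 0 s := fun s => h _ (.inr ⟨s, rfl⟩)
        funext i s
        fin_cases i
        · exact hb s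
        · exact add_right_cancel ((hc s).trans (congrArg (ω' 1 s + ·) (hb s).symm))
      have hetaStar : ∀ ω ω', (∀ f ∈ P.dagger.incoming .etaStar, Y f ω = Y f ω') → ω = ω' := by
        intro ω ω' h
        rw [dagger_incoming_etaStar] at h
        have ha : ∀ s, ω 1 s = ω' 1 s := fun s => h _ (.inl ⟨s, rfl⟩)
        have hc : ∀ s, ω 1 s + ω 0 s = ω' 1 s + ω' 0 s := fun s => h _ (.inr ⟨s, rfl⟩)
        funext i s
        fin_cases i
        · exact add_left_cancel ((hc s).trans (congrArg (· + ω' 0 s) (ha s).symm))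
        · exact ha s
      intro i w hw ω ω' h
      fin_cases i
      · refine hY 0 ω ω' ?_
        rcases hw with ⟨s, u, rfl⟩ | rfl | rfl | rfl
        · rw [dagger_incoming_tau] at h
          -- At τ_{s,u} the edge d carries a_s, and subtracting it from c_s removes the mask from
          -- b_s.
          have ha : ω 1 s = ω' 1 s := h _ (.inr (.inr rfl))
          have hc : ω 1 s + ω 0 s = ω' 1 s + ω' 0 s := h _ (.inr (.inl rfl))
          funext j
          by_cases hj : j = s
          · subst hj
            exact add_left_cancel ((hc).trans (by rw [ha]))
          · exact h _ (.inl ⟨j, hj, rfl⟩)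
        · rw [heta ω ω' h]
        · rw [hetaStar ω ω' h]
        · rw [dagger_incoming_psi] at h
          exact funext fun s => h _ ⟨s, rfl⟩
      · refine hY 1 ω ω' ?_
        rcases hw with rfl | rfl
        · rw [heta ω ω' h]
        · rw [hetaStar ω ω' h]
  obtain ⟨D, hD, hlog⟩ := key
  have card_of_surj : ∀ f, Function.Surjective (Y f) →
      D.logSupport f = Real.log (Nat.card (A f)) := by
    intro f hf
    rw [hlog, hf.range_eq, Set.ncard_univ]
  have eval_surj : ∀ (i : Fin 2) (s : S),
      Function.Surjective fun ω : Fin 2 → ∀ s, G s => ω i s := fun i s =>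
    (Function.surjective_eval s).comp (Function.surjective_eval i)
  refine ⟨D, hD, fun i => ?_, fun s => card_of_surj _ (eval_surj 1 s),
    fun s => card_of_surj _ (eval_surj 0 s), fun s => card_of_surj _ fun g => ?_,
    fun s u => card_of_surj _ (eval_surj 1 s), fun e => ?_⟩
  · rw [card_of_surj (.inl i) ((equivShrink _).surjective.comp (Function.surjective_eval i)),
      ← Nat.card_congr (equivShrink.{0} (∀ s, G s)), Nat.card_pi, Nat.cast_prod, Real.log_prod]
    exact fun s _ => by exact_mod_cast Nat.card_pos.ne'
  · exact ⟨![Pi.single s g, 0], by simp [Y]⟩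
  · let T := (C.prob.map (C.Y (.inr e))).support
    have hsub : Set.range (Y (.inr (.orig e))) ⊆
        Set.range fun (w : Fin k → T) i => (w i : C.Alphabet (.inr e)) := by
      rintro _ ⟨ω, rfl⟩
      refine ⟨fun i => ⟨word (.inr e) (ω 1) i, ?_⟩, rfl⟩
      exact (PMF.support_map _ _).ge ⟨_, hτ _, rfl⟩
    have hcard : (Set.range (Y (.inr (.orig e)))).ncard ≤ T.ncard ^ k := by
      refine (Set.ncard_le_ncard hsub (Set.toFinite _)).trans ?_
      refine (Finite.card_range_le _).trans ?_
      simp [Nat.card_fun, Set.ncard]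
    have hpos : 0 < (Set.range (Y (.inr (.orig e)))).ncard :=
      (Set.ncard_pos).2 (Set.range_nonempty _)
    rw [hlog, NetworkCode.logSupport, ← Real.log_pow]
    exact Real.log_le_log (by exact_mod_cast hpos) (by exact_mod_cast hcard)

/-! ### Rates -/

theorem NetworkCode.ncard_support_pos (C : P.NetworkCode) (f : S ⊕ E) :
    0 < (C.prob.map (C.Y f)).support.ncard := by
  have := C.finite_alphabet
  exact (Set.ncard_pos).2 (PMF.support_nonempty _)

theorem NetworkCode.logSupport_nonneg (C : P.NetworkCode) (f : S ⊕ E) : 0 ≤ C.logSupport f :=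
  Real.log_natCast_nonneg _

/-- For x ≥ 1 the floor is at least x / 2, so rounding costs at most log 2, which the factor `d n`
makes negligible. -/
theorem tendsto_mul_log_floor_exp {l : ℝ} (hl : 0 ≤ l) {d : ℕ → ℝ} (hd : ∀ n, 0 < d n)
    (h0 : Tendsto d atTop (𝓝 0)) :
    Tendsto (fun n => d n * Real.log (⌊Real.exp (l / d n)⌋₊ : ℝ)) atTop (𝓝 l) := by
  have hone : ∀ n, 1 ≤ Real.exp (l / d n) := fun n => Real.one_le_exp (div_nonneg hl (hd n).le)
  have hpos : ∀ n, (1 : ℝ) ≤ ⌊Real.exp (l / d n)⌋₊ := fun n => by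
    exact_mod_cast Nat.one_le_floor_iff _ |>.2 (hone n)
  have lim : Tendsto (fun n => l - d n * Real.log 2) atTop (𝓝 l) := by
    simpa using tendsto_const_nhds.sub (h0.mul_const (Real.log 2))
  refine tendsto_of_tendsto_of_tendsto_of_le_of_le lim tendsto_const_nhds (fun n => ?_) fun n => ?_
  · have h1 : Real.exp (l / d n) ≤ ⌊Real.exp (l / d n)⌋₊ * 2 := by
      linarith [Nat.lt_floor_add_one (Real.exp (l / d n)), hpos n]
    have h2 := Real.log_le_log (Real.exp_pos _) h1
    rw [Real.log_exp, Real.log_mul (by linarith [hpos n]) two_ne_zero, div_le_iff₀ (hd n)] at h2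
    simp only
    linarith
  · have h1 := Real.log_le_log (by linarith [hpos n])
      (Nat.floor_le (zero_le_one.trans (hone n)))
    rw [Real.log_exp, le_div_iff₀ (hd n)] at h1
    simp only
    linarith

/-- The given codes may exceed rate λ(s), but a_s, b_s, c_s and d_{s,u} have capacity only λ(s), so
the messages are truncated. Truncation can destroy convergence on the original edges, hence the
passage to a subsequence. -/
theorem zeroErrorAchievable_dagger {t : Tuple E S}
    (ht : P.daggerTuple t ∈ P.dagger.rateCapacityTuples)
    (h : P.ZeroErrorAchievable t) : P.dagger.ZeroErrorAchievable (P.daggerTuple t) := by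
  obtain ⟨ht0, C, ⟨c, hc, hS, hE⟩, hC⟩ := h
  choose lS hlS hlS' using hS
  choose lE hlE hlE' using hE
  -- long blocks
  let k : ℕ → ℕ := fun n => ⌈c n⌉₊ * (n + 1)
  have hk : ∀ n, 0 < (k n : ℝ) := fun n => by
    have := Nat.ceil_pos.2 (hc n)
    exact_mod_cast Nat.mul_pos this n.succ_pos
  let d : ℕ → ℝ := fun n => c n / k n
  have hd : ∀ n, 0 < d n := fun n => div_pos (hc n) (hk n)
  have hdk : ∀ n x, d n * (k n * x) = c n * x := fun n x => by
    rw [← mul_assoc, div_mul_cancel₀ _ (hk n).ne']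
  -- The factor `⌈c n⌉₊` in `k n` yields `d n ≤ 1 / (n + 1)`.
  have hd0 : Tendsto d atTop (𝓝 0) := by
    refine squeeze_zero (fun n => (hd n).le) (fun n => ?_) tendsto_one_div_add_atTop_nhds_zero_nat
    rw [div_le_div_iff₀ (hk n) n.cast_add_one_pos, one_mul]
    push_cast [k]
    exact mul_le_mul_of_nonneg_right (Nat.le_ceil _) n.cast_add_one_pos.le
  -- message sizes
  let N : ℕ → S → ℕ := fun n s => ((C n).prob.map ((C n).Y (.inl s))).support.ncard
  -- The first bound lets the messages embed into `k n` letters of the code; the second caps their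
  -- rate at λ(s).
  let m : ℕ → S → ℕ := fun n s => min (N n s ^ k n) ⌊Real.exp (t.1 s / d n)⌋₊
  have hfl : ∀ n s, 0 < ⌊Real.exp (t.1 s / d n)⌋₊ := fun n s =>
    Nat.floor_pos.2 (Real.one_le_exp (div_nonneg (ht0.1 s) (hd n).le))
  have hN : ∀ n s, 0 < N n s ^ k n := fun n s => pow_pos ((C n).ncard_support_pos _) _
  -- Nonzero size makes `Fin (m n s)` a cyclic group, as the one-time pad requires.
  have hm : ∀ n s, NeZero (m n s) := fun n s => ⟨(lt_min (hN n s) (hfl n s)).ne'⟩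
  have hmlim : ∀ s, Tendsto (fun n => d n * Real.log (m n s)) atTop (𝓝 (t.1 s)) := by
    intro s
    have h1 := (hlS s).min (tendsto_mul_log_floor_exp (ht0.1 s) hd hd0)
    rw [min_eq_right (hlS' s)] at h1
    refine h1.congr fun n => ?_
    have hN' : (0 : ℝ) < (N n s ^ k n : ℕ) := by exact_mod_cast hN n s
    have hfl' : (0 : ℝ) < ⌊Real.exp (t.1 s / d n)⌋₊ := by exact_mod_cast hfl n s
    have h2 : Real.log (m n s) = min (Real.log (N n s ^ k n : ℕ))
        (Real.log ⌊Real.exp (t.1 s / d n)⌋₊) := by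
      rw [Nat.cast_min]
      rcases le_total ((N n s ^ k n : ℕ) : ℝ) ⌊Real.exp (t.1 s / d n)⌋₊ with h | h
      · rw [min_eq_left h, min_eq_left (Real.log_le_log hN' h)]
      · rw [min_eq_right h, min_eq_right (Real.log_le_log hfl' h)]
    rw [h2, mul_min_of_nonneg _ _ (hd n).le, Nat.cast_pow, Real.log_pow, hdk]
    rfl
  have hι : ∀ n s, ∃ ι : Fin (m n s) → Fin (k n) → ((C n).prob.map ((C n).Y (.inl s))).support,
      Function.Injective ι := by
    intro n s
    have := (C n).finite_alphabet
    have := Fintype.ofFinite ((C n).prob.map ((C n).Y (.inl s))).support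
    obtain ⟨ι⟩ := Function.Embedding.nonempty_of_card_le
      (α := Fin (m n s)) (β := Fin (k n) → ((C n).prob.map ((C n).Y (.inl s))).support) (by
        rw [Fintype.card_fin, Fintype.card_fun, Fintype.card_fin, ← Nat.card_eq_fintype_card]
        exact min_le_left _ _)
    exact ⟨ι, ι.injective⟩
  choose ι hι using hι
  choose D hD hD1 hDa hDb hDc hDd hDe using fun n => (C n).exists_dagger (hC n) (k n) (ι n) (hι n)
  simp only [Nat.card_fin] at hD1 hDa hDb hDc hDd
  -- the capacities of the original edges converge along a subsequence
  have hle : ∀ n e, d n * (D n).logSupport (.inr (.orig e)) ≤ c n * (C n).logSupport (.inr e) :=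
    fun n e => (mul_le_mul_of_nonneg_left (hDe n e) (hd n).le).trans_eq (hdk _ _)
  choose M hM using fun e => (hlE e).bddAbove_range
  obtain ⟨l, -, σ, hσ, hl⟩ := (isCompact_Icc (a := fun _ : E => (0 : ℝ)) (b := M)).tendsto_subseq
    (x := fun n e => d n * (D n).logSupport (.inr (.orig e))) fun n =>
      ⟨fun e => mul_nonneg (hd n).le ((D n).logSupport_nonneg _),
        fun e => (hle n e).trans (hM e ⟨n, rfl⟩)⟩
  have hl' := tendsto_pi_nhds.1 hl
  have hmlim' := fun s => (hmlim s).comp hσ.tendsto_atTop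
  refine ⟨ht, fun n => D (σ n), ⟨fun n => d (σ n), fun n => hd _, fun i => ?_, ?_⟩, fun n => hD _⟩
  · refine ⟨∑ s, t.1 s, ?_, le_rfl⟩
    refine (tendsto_finsetSum _ fun s _ => hmlim' s).congr fun n => ?_
    simp [hD1, Finset.mul_sum]
  · rintro (e | s | s | s | ⟨s, u⟩)
    · exact ⟨l e, hl' e, (le_of_tendsto_of_tendsto' (hl' e) ((hlE e).comp hσ.tendsto_atTop)
        fun n => hle _ e).trans (hlE' e)⟩
    · exact ⟨t.1 s, (hmlim' s).congr fun n => by simp [hDa], le_rfl⟩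
    · exact ⟨t.1 s, (hmlim' s).congr fun n => by simp [hDb], le_rfl⟩
    · exact ⟨t.1 s, (hmlim' s).congr fun n => by simp [hDc], le_rfl⟩
    · exact ⟨t.1 s, (hmlim' s).congr fun n => by simp [hDd], le_rfl⟩

end NetworkCodingProblem

theorem mainTheorem8 {V E S : Type*} [Finite V] [Finite E] [Fintype S]
    (P : NetworkCodingProblem V E S) :
    P.dagger.Colocated ∧ P.dagger.IncrementalMulticast ∧
    ∀ t ∈ P.rateCapacityTuples,
      P.daggerTuple t ∈ P.dagger.rateCapacityTuples ∧
      (P.daggerTuple t ∈ P.dagger.yeungOuterBound → t ∈ P.yeungOuterBound) ∧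
      (P.ZeroErrorAchievable t → P.dagger.ZeroErrorAchievable (P.daggerTuple t)) := by
  refine ⟨fun _ _ => rfl, ?_, fun t ht => ?_⟩
  · intro i s his
    obtain ⟨rfl, rfl⟩ : i = 0 ∧ s = 1 := by omega
    rintro w (rfl | rfl)
    · exact .inr (.inl rfl)
    · exact .inr (.inr (.inl rfl))
  · have hd : P.daggerTuple t ∈ P.dagger.rateCapacityTuples := by
      refine ⟨fun _ => Finset.sum_nonneg fun s _ => ht.1 s, ?_⟩
      rintro (e | s | s | s | ⟨s, u⟩)
      exacts [ht.2 e, ht.1 s, ht.1 s, ht.1 s, ht.1 s]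
    exact ⟨hd, NetworkCodingProblem.mem_yeungOuterBound_of_dagger ht,
      NetworkCodingProblem.zeroErrorAchievable_dagger hd⟩
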